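/- Let $(X,d)$ be a metric space with integer-valued metric. A split of $X$ is an unordered pair $S=\{A,B\}$ of non-empty disjoint subsets with $A\cup B=X$; put $\delta_S(x,y)=0$ if $x,y$ lie in the same part of $S$ and $\delta_S(x,y)=1$ otherwise, and $$\alpha_S=\tfrac12\inf_{a,a'\in A,\ b,b'\in B}\bigl[\max\{d(a,b)+d(a',b'),\,d(a',b)+d(a,b'),\,d(a,a')+d(b,b')\}-d(a,a')-d(b,b')\bigr].$$ The $d$-splits are the splits with $\alpha_S>0$. Let $$\mathrm E(X,d)=\{f\in\mathbb R^X: f(x)=\sup_{y\in X}(d(x,y)-f(y))\ \text{for all } x\in X\}$$ be the injective hull of $(X,d)$. For $f\in\mathbb R^X$ let $A(f)$ be the set of unordered pairs $\{x,y\}$ (with $x=y$ allowed) such that $f(x)+f(y)=d(x,y)$, and let $\mathrm E'(X,d)$ be the set of all $f\in\mathbb R^X$ such that $f(x)+f(y)\ge d(x,y)$ for all $x,y\in X$ and every point of $X$ belongs to some pair in $A(f)$. For $f\in \mathrm E'(X,d)$ let $H(A(f))=\{g\in\mathbb R^X: A(f)\subset A(g)\}$, an affine subspace of $\mathbb R^X$.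 The cells of $\mathrm E(X,d)$ are the sets $\mathrm E(X,d)\cap H(A(f))$ with $f\in\mathrm E'(X,d)$. Assume that 1. $(X,d)$ is totally split-decomposable: $d=\sum_S\alpha_S\delta_S$, the sum being over all $d$-splits $S$ of $X$; 2. $(X,d)$ satisfies the local rank condition: for every $f\in\mathrm E(X,d)$ there are $\varepsilon>0$ and $N\in\mathbb N$ such that $\dim H(A(g))\le N$ for all $g\in\mathrm E'(X,d)$ with $\|f-g\|_\infty<\varepsilon$; 3. every cell of $\mathrm E(X,d)$ is a combinatorial hypercube, i.e. a convex polytope whose face lattice is isomorphic to the face lattice of a cube $[0,1]^n$ for some $n\ge 0$. Then $\mathrm E(X,d)$ satisfies the CAT(0) link condition: for every integer $k\ge0$ and all cells $C$, $C_1^1,C_1^2,C_1^3$, $C_2^1,C_2^2,C_2^3$ of $\mathrm E(X,d)$ such that $$C=C_2^1\cap C_2^2\cap C_2^3,\qquad C_1^j=\bigcap_{i\in\{1,2,3\}\setminus\{j\}}C_2^i\quad(j=1,2,3),$$ and $\dim C=k$, $\dim C_1^i=k+1$, $\dim C_2^i=k+2$ for $i=1,2,3$, there is a cell $\bar C$ of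 $\mathrm E(X,d)$ with $\dim\bar C=k+3$ and $C_2^1\cup C_2^2\cup C_2^3\subset\bar C$. -/

import Mathlib

namespace InjHull

/-! ### Splits and isolation indices -/

/-- A split `{A, B}` of `X`: an unordered pair of non-empty disjoint subsets with union `X`. -/
def Split (X : Type*) : Type _ :=
  {S : Sym2 (Set X) // ∃ A B : Set X,
    S = s(A, B) ∧ A.Nonempty ∧ B.Nonempty ∧ Disjoint A B ∧ A ∪ B = Set.univ}

open Classical in
/-- The split pseudometric `δ_S`: it vanishes at `(x, y)` if `x` and `y` lie in the same part of
`S`, and equals `1` otherwise. -/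
noncomputable def Split.delta {X : Type*} (S : Split X) (x y : X) : ℝ :=
  if ∃ A ∈ S.1, x ∈ A ∧ y ∈ A then 0 else 1

/-- The isolation index of a pair of subsets. The infimum is over a set of non-negative reals,
which is non-empty as soon as `A` and `B` are. -/
noncomputable def isolationIndex {X : Type*} [PseudoMetricSpace X] (A B : Set X) : ℝ :=
  (1 / 2) * sInf {r : ℝ | ∃ a ∈ A, ∃ a' ∈ A, ∃ b ∈ B, ∃ b' ∈ B,
    r = max (dist a b + dist a' b') (max (dist a' b + dist a b') (dist a a' + dist b b'))
      - dist a a' - dist b b'}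

theorem isolationIndex_comm {X : Type*} [PseudoMetricSpace X] (A B : Set X) :
    isolationIndex A B = isolationIndex B A := by
  have key : ∀ A B : Set X, ∀ r : ℝ,
      (∃ a ∈ A, ∃ a' ∈ A, ∃ b ∈ B, ∃ b' ∈ B,
        r = max (dist a b + dist a' b') (max (dist a' b + dist a b') (dist a a' + dist b b'))
          - dist a a' - dist b b') →
      ∃ a ∈ B, ∃ a' ∈ B, ∃ b ∈ A, ∃ b' ∈ A,
        r = max (dist a b + dist a' b') (max (dist a' b + dist a b') (dist a a' + dist b b'))
          - dist a a' - dist b b' := by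
    rintro A B r ⟨a, ha, a', ha', b, hb, b', hb', rfl⟩
    refine ⟨b, hb, b', hb', a, ha, a', ha', ?_⟩
    rw [dist_comm b a, dist_comm b' a', dist_comm b' a, dist_comm b a',
      add_comm (dist b b') (dist a a'), add_comm (dist a b') (dist a' b)]
    ring
  unfold isolationIndex
  congr 2
  ext r
  exact ⟨key A B r, key B A r⟩

/-- The isolation index `α_S` of a split. -/
noncomputable def Split.alpha {X : Type*} [PseudoMetricSpace X] (S : Split X) : ℝ :=
  Sym2.lift ⟨isolationIndex, isolationIndex_comm⟩ S.1

/-- The `d`-splits: the splits of positive isolation index. -/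
def dSplits (X : Type*) [PseudoMetricSpace X] : Set (Split X) := {S | 0 < S.alpha}

/-- `d = ∑ α_S δ_S`, the sum being over all `d`-splits. -/
def TotallySplitDecomposable (X : Type*) [PseudoMetricSpace X] : Prop :=
  ∀ x y : X, HasSum (fun S : dSplits X => S.1.alpha * S.1.delta x y) (dist x y)

def IntegerValued (X : Type*) [PseudoMetricSpace X] : Prop :=
  ∀ x y : X, ∃ n : ℤ, dist x y = n

/-! ### The injective hull and its cells -/

/-- Isbell's injective hull `E(X, d)`: the functions `f` with
`f x = sup_y (d(x, y) - f y)` for all `x`. -/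
def hull (X : Type*) [PseudoMetricSpace X] : Set (X → ℝ) :=
  {f | ∀ x, IsLUB (Set.range fun y => dist x y - f y) (f x)}

def Delta (X : Type*) [PseudoMetricSpace X] : Set (X → ℝ) :=
  {f | ∀ x y, dist x y ≤ f x + f y}

/-- The edge set `A(f)`; loops are allowed. -/
def edges {X : Type*} [PseudoMetricSpace X] (f : X → ℝ) : Set (Sym2 X) :=
  {e | ∃ x y, e = s(x, y) ∧ f x + f y = dist x y}

/-- `E'(X, d)`: the `f ∈ Δ(X, d)` such that the edges of `A(f)` cover `X`. -/
def hull' (X : Type*) [PseudoMetricSpace X] : Set (X → ℝ) :=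
  {f | f ∈ Delta X ∧ ∀ x, ∃ e ∈ edges f, x ∈ e}

/-- The affine subspace `H(A) = {g | A ⊆ A(g)}`. -/
def affH {X : Type*} [PseudoMetricSpace X] (A : Set (Sym2 X)) : AffineSubspace ℝ (X → ℝ) where
  carrier := {g | ∀ x y, s(x, y) ∈ A → g x + g y = dist x y}
  smul_vsub_vadd_mem' := by
    intro c p q r hp hq hr x y hxy
    have h1 := hp x y hxy
    have h2 := hq x y hxy
    have h3 := hr x y hxy
    simp only [vsub_eq_sub, vadd_eq_add, Pi.add_apply, Pi.smul_apply, Pi.sub_apply, smul_eq_mul]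
    linear_combination c * h1 - c * h2 + h3

/-- `rank A = dim H(A)`, possibly infinite. -/
noncomputable def rk {X : Type*} [PseudoMetricSpace X] (A : Set (Sym2 X)) : Cardinal :=
  Module.rank ℝ (affH A).direction

/-- The local rank condition; `∃ r < ε, ∀ x, |f x - g x| ≤ r` says `‖f - g‖_∞ < ε`.
It holds automatically if `X` is finite. -/
def LocalRankCondition (X : Type*) [PseudoMetricSpace X] : Prop :=
  ∀ f ∈ hull X, ∃ ε > (0 : ℝ), ∃ N : ℕ, ∀ g ∈ hull' X,
    (∃ r < ε, ∀ x, |f x - g x| ≤ r) → rk (edges g) ≤ N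

/-- The cells of `E(X, d)`: the sets `P(A) = E(X, d) ∩ H(A)` for `A` admissible, that is
`A = A(f)` for some `f ∈ E'(X, d)`. -/
def cells (X : Type*) [PseudoMetricSpace X] : Set (Set (X → ℝ)) :=
  {C | ∃ f ∈ hull' X, C = hull X ∩ (affH (edges f) : Set (X → ℝ))}

/-! ### Combinatorial hypercubes and the link condition -/

/-- The faces of a convex set, the empty face and the set itself included; ordered by inclusion. -/
abbrev Faces {V : Type*} [AddCommGroup V] [Module ℝ V] (C : Set V) : Type _ :=
  {F : Set V // Convex ℝ F ∧ IsExtreme ℝ C F}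

/-- A convex polytope whose face lattice is isomorphic to the one of a cube `[0, 1]^n`. -/
def IsCombinatorialHypercube {V : Type*} [AddCommGroup V] [Module ℝ V] (C : Set V) : Prop :=
  (∃ s : Finset V, C = convexHull ℝ (s : Set V)) ∧
    ∃ n : ℕ, Nonempty (Faces C ≃o Faces (Set.Icc (0 : Fin n → ℝ) 1))

/-- The dimension of a convex set: the dimension of its affine hull. -/
noncomputable def cellDim {V : Type*} [AddCommGroup V] [Module ℝ V] (C : Set V) : Cardinal :=
  Module.rank ℝ (vectorSpan ℝ C)

/-- The CAT(0) link condition, for a complex given by its set of cells. -/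
def CAT0LinkCondition {V : Type*} [AddCommGroup V] [Module ℝ V] (K : Set (Set V)) : Prop :=
  ∀ (k : ℕ) (C : Set V) (C₁ C₂ : Fin 3 → Set V),
    C ∈ K → (∀ i, C₁ i ∈ K) → (∀ i, C₂ i ∈ K) →
    C = ⋂ i, C₂ i →
    (∀ j, C₁ j = ⋂ i, ⋂ (_ : i ≠ j), C₂ i) →
    cellDim C = k →
    (∀ i, cellDim (C₁ i) = (k + 1 : ℕ)) →
    (∀ i, cellDim (C₂ i) = (k + 2 : ℕ)) →
    ∃ D ∈ K, cellDim D = (k + 3 : ℕ) ∧ (⋃ i, C₂ i) ⊆ D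

end InjHull

/-! Choose `e j` and `f i` whose edge sets define the cells `C₁ j` and `C₂ i`. The cell sought is
that of the barycentre `h` of `e 0`, `e 1`, `e 2`, whose edges are exactly the edges common to the
three `e j`. The crux is `h ∈ hull' X`, that is, that these common edges cover `X`. Any two of the
`e j` lie in one `C₂ i` and so share its edges, which cover `X`; `exists_common_edge` is a Helly
property that turns pairwise common neighbours into a triple one. It rests on the four-point
inequality `dist_add_dist_lt_max_of_not_edge`: were it false, total decomposability would supply
three `d`-splits halving one quadruple in the three possible ways, which is impossible.

Two distinct facets of `C₂ i` have only its edges in common, so `C₂ i ⊆ cellOf h`. As a proper face,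
`C₂ 0` forces dimension at least `k + 3`. Conversely, `h` is relatively interior to its cell, so no
proper face contains all the `C₁ j`; and in a cube, three `(k+1)`-faces through one `k`-face lie in
a face of dimension at most `k + 3`. Combinatorial cubes inherit this because the face lattice
determines dimensions. Integrality and the local rank condition serve to make `h` relatively
interior: they bound the positive slacks `h x + h y - dist x y` away from zero even when `X` is
infinite. -/

namespace InjHull

/-! ### Four-point inequalities from `d`-splits. -/

section SplitMetrics

variable {X : Type*} [PseudoMetricSpace X]

/-- Every split has the form `{A, Aᶜ}`. -/
theorem Split.exists_side (S : Split X) : ∃ A : Set X, S.alpha = isolationIndex A Aᶜ ∧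
    ∀ x y, (S.delta x y = 0 ∧ (x ∈ A ↔ y ∈ A)) ∨ (S.delta x y = 1 ∧ ¬ (x ∈ A ↔ y ∈ A)) := by
  obtain ⟨S, A, B, rfl, -, -, hAB, hU⟩ := S
  obtain rfl : B = Aᶜ := (isCompl_iff.2 ⟨hAB, codisjoint_iff.2 hU⟩).compl_eq.symm
  refine ⟨A, rfl, fun x y => ?_⟩
  by_cases h : x ∈ A ↔ y ∈ A
  · refine Or.inl ⟨if_pos ?_, h⟩
    by_cases hx : x ∈ A
    · exact ⟨A, Sym2.mem_mk_left _ _, hx, h.1 hx⟩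
    · exact ⟨Aᶜ, Sym2.mem_mk_right _ _, hx, fun hy => hx (h.2 hy)⟩
  · refine Or.inr ⟨if_neg ?_, h⟩
    rintro ⟨B, hB, hx, hy⟩
    rcases Sym2.mem_iff.1 hB with rfl | rfl
    · exact h ⟨fun _ => hy, fun _ => hx⟩
    · exact h ⟨fun h' => absurd h' hx, fun h' => absurd h' hy⟩

/-- The infimum is over a set bounded below by `0`, since the third entry of the maximum cancels the
subtracted terms. A positive infimum means that this third entry is never the maximum. -/
theorem lt_max_of_isolationIndex_pos {A B : Set X} (h : 0 < isolationIndex A B) {a a' b b' : X}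
    (ha : a ∈ A) (ha' : a' ∈ A) (hb : b ∈ B) (hb' : b' ∈ B) :
    dist a a' + dist b b' < max (dist a b + dist a' b') (dist a' b + dist a b') := by
  unfold isolationIndex at h
  have h1 := csInf_le (s := {r : ℝ | ∃ a ∈ A, ∃ a' ∈ A, ∃ b ∈ B, ∃ b' ∈ B,
    r = max (dist a b + dist a' b') (max (dist a' b + dist a b') (dist a a' + dist b b'))
      - dist a a' - dist b b'}) ⟨0, by
      rintro r ⟨a, -, a', -, b, -, b', -, rfl⟩
      linarith [le_max_right (dist a b + dist a' b')
        (max (dist a' b + dist a b') (dist a a' + dist b b')),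
        le_max_right (dist a' b + dist a b') (dist a a' + dist b b')]⟩
      ⟨a, ha, a', ha', b, hb, b', hb', rfl⟩
  by_contra hcon
  push Not at hcon
  obtain ⟨h2, h3⟩ := max_le_iff.1 hcon
  have : max (dist a b + dist a' b') (max (dist a' b + dist a b') (dist a a' + dist b b'))
      ≤ dist a a' + dist b b' := max_le h2 (max_le h3 le_rfl)
  linarith

/-- A `d`-split witnesses a strict four-point inequality on each quadruple that it halves. -/
theorem lt_max_of_mem_dSplits {S : Split X} (hS : S ∈ dSplits X) {x y z w : X}
    (hxy : S.delta x y = 0) (hzw : S.delta z w = 0) (hxz : S.delta x z = 1) :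
    dist x y + dist z w < max (dist x z + dist y w) (dist y z + dist x w) := by
  obtain ⟨A, hA, hd⟩ := S.exists_side
  have hpos : 0 < isolationIndex A Aᶜ := hA ▸ hS
  have h1 := hd x y
  have h2 := hd z w
  have h3 := hd x z
  simp only [hxy, hzw, hxz, true_and, zero_ne_one, one_ne_zero, false_and, or_false,
    false_or] at h1 h2 h3
  by_cases hx : x ∈ A
  · refine lt_max_of_isolationIndex_pos hpos hx (h1.1 hx) ?_ ?_ <;>
    · simp only [Set.mem_compl_iff]; tauto
  · rw [isolationIndex_comm] at hpos
    exact lt_max_of_isolationIndex_pos hpos hx (show y ∉ A by tauto) (by tauto) (by tauto)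

/-- A linear inequality between distances that holds for all `d`-splits holds for `d`. -/
theorem TotallySplitDecomposable.exists_pos (h : TotallySplitDecomposable X) {n : ℕ}
    (c : Fin n → ℝ) (p q : Fin n → X) (hpos : 0 < ∑ i, c i * dist (p i) (q i)) :
    ∃ S ∈ dSplits X, 0 < ∑ i, c i * S.delta (p i) (q i) := by
  by_contra! hcon
  have hs := hasSum_sum (s := Finset.univ) fun i _ => (h (p i) (q i)).mul_left (c i)
  refine hpos.not_ge (hasSum_le (fun S => ?_) hs hasSum_zero)
  have := mul_nonpos_of_nonneg_of_nonpos (le_of_lt S.2) (hcon S.1 S.2)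
  rw [Finset.mul_sum] at this
  refine le_of_eq_of_le (Finset.sum_congr rfl fun i _ => ?_) this
  ring

/-- Three `d`-splits cannot induce the three different halvings of a quadruple. -/
theorem dSplits_weaklyCompatible {S T U : Split X} (hS : S ∈ dSplits X) (hT : T ∈ dSplits X)
    (hU : U ∈ dSplits X) {x y z w : X}
    (hS₁ : S.delta x y = 0) (hS₂ : S.delta z w = 0) (hS₃ : S.delta x z = 1)
    (hT₁ : T.delta x z = 0) (hT₂ : T.delta y w = 0) (hT₃ : T.delta x y = 1)
    (hU₁ : U.delta x w = 0) (hU₂ : U.delta y z = 0) (hU₃ : U.delta x y = 1) : False := by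
  -- Each of the three pairing sums of the quadruple is strictly below the larger of the other two,
  -- so none could be the largest.
  have h1 := lt_max_of_mem_dSplits hS hS₁ hS₂ hS₃
  have h2 := lt_max_of_mem_dSplits hT hT₁ hT₂ hT₃
  have h3 := lt_max_of_mem_dSplits hU hU₁ hU₂ hU₃
  rw [lt_max_iff] at h1 h2 h3
  have e1 := dist_comm y z
  have e2 := dist_comm w z
  have e3 := dist_comm w y
  rcases h1 with h1 | h1 <;> rcases h2 with h2 | h2 <;> rcases h3 with h3 | h3 <;> linarith

/-- If this fails, no `d`-split separates `x, y` from `z, z'`. The tight pairs and the strict slack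
at `x, y` make three combinations of distances positive; the splits witnessing this halve `x, z, z',
w` in all three ways. -/
theorem dist_add_dist_lt_max_of_not_edge (h : TotallySplitDecomposable X) {g : X → ℝ}
    (hg : g ∈ Delta X) {x y z z' w : X} (hxz : g x + g z = dist x z)
    (hxz' : g x + g z' = dist x z') (hyw : g y + g w = dist y w) (hxy : g x + g y ≠ dist x y) :
    dist x y + dist z z' < max (dist x z + dist y z') (dist y z + dist x z') := by
  by_contra hcon
  have hxy : dist x y < g x + g y := lt_of_le_of_ne (hg x y) hxy.symm
  have hno : ∀ S ∈ dSplits X, S.delta x y = 0 → S.delta z z' = 0 → S.delta x z = 1 → False :=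
    fun S hS h1 h2 h3 => hcon (lt_max_of_mem_dSplits hS h1 h2 h3)
  obtain ⟨S, hS, hSp⟩ := h.exists_pos ![1, 1, -1, -1] ![x, y, x, z] ![z, w, y, w] (by
    simp [Fin.sum_univ_succ]
    linarith [hg z w])
  obtain ⟨T, hT, hTp⟩ := h.exists_pos ![1, 1, -1, -1] ![x, y, x, z'] ![z', w, y, w] (by
    simp [Fin.sum_univ_succ]
    linarith [hg z' w])
  obtain ⟨U, hU, hUp⟩ := h.exists_pos ![1, 1, 1, -1, -1, -1] ![x, x, y, x, z, x]
    ![z, z', w, y, z', w] (by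
    simp [Fin.sum_univ_succ]
    linarith [hg z z', hg x w])
  simp [Fin.sum_univ_succ] at hSp hTp hUp
  -- Positivity forces `S` to separate `x, y` from `z, w`; the excluded halving then puts `z'` on
  -- the side of `x`. `T` is the same with `z` and `z'` exchanged.
  have hS' : S.delta x z' = 0 ∧ S.delta z w = 0 ∧ S.delta x z = 1 := by
    have hn := hno S hS
    obtain ⟨A, -, hd⟩ := S.exists_side
    have := hd x y; have := hd x z; have := hd x z'; have := hd x w
    have := hd z w; have := hd z z'; have := hd y w
    grind
  have hT' : T.delta x z = 0 ∧ T.delta z' w = 0 ∧ T.delta x z' = 1 := by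
    have hn := hno T hT
    obtain ⟨A, -, hd⟩ := T.exists_side
    have := hd x y; have := hd x z; have := hd x z'; have := hd x w
    have := hd z' w; have := hd z z'; have := hd y w
    grind
  -- Positivity puts `z, z'` across from `x`, and at least one of `y, w` with `x`. The excluded
  -- halving rules out `y`.
  have hU' : U.delta x w = 0 ∧ U.delta z' z = 0 ∧ U.delta x z' = 1 := by
    have hn := hno U hU
    obtain ⟨A, -, hd⟩ := U.exists_side
    have := hd x y; have := hd x z; have := hd x z'; have := hd x w
    have := hd z' z; have := hd z z'; have := hd y w
    grind
  exact dSplits_weaklyCompatible hS hT hU hS'.1 hS'.2.1 hS'.2.2 hT'.1 hT'.2.1 hT'.2.2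
    hU'.1 hU'.2.1 hU'.2.2

end SplitMetrics

/-! ### Cells of the hull, their faces and the Helly property. -/

section Cells

variable {X : Type*} [PseudoMetricSpace X]

theorem mk_mem_edges {f : X → ℝ} {x y : X} : s(x, y) ∈ edges f ↔ f x + f y = dist x y := by
  refine ⟨?_, fun h => ⟨x, y, rfl, h⟩⟩
  rintro ⟨a, b, hab, h⟩
  rcases Sym2.eq_iff.1 hab with ⟨rfl, rfl⟩ | ⟨rfl, rfl⟩
  · exact h
  · rw [add_comm, h, dist_comm]

theorem mem_hull'_iff {f : X → ℝ} :
    f ∈ hull' X ↔ f ∈ Delta X ∧ ∀ x, ∃ y, f x + f y = dist x y := by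
  refine and_congr_right fun _ => forall_congr' fun x => ⟨?_, ?_⟩
  · rintro ⟨e, he, hx⟩
    obtain ⟨y, rfl⟩ := hx
    exact ⟨y, mk_mem_edges.1 he⟩
  · rintro ⟨y, hy⟩
    exact ⟨s(x, y), mk_mem_edges.2 hy, Sym2.mem_mk_left _ _⟩

theorem hull_subset_Delta : hull X ⊆ Delta X := fun f hf x y => by
  have := (hf x).1 ⟨y, rfl⟩
  simp only at this
  linarith

theorem hull'_subset_hull : hull' X ⊆ hull X := fun f hf x => by
  obtain ⟨h1, h2⟩ := mem_hull'_iff.1 hf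
  refine ⟨?_, fun b hb => ?_⟩
  · rintro _ ⟨y, rfl⟩
    have := h1 x y
    simp only
    linarith
  · obtain ⟨y, hy⟩ := h2 x
    have := hb ⟨y, rfl⟩
    simp only at this
    linarith

/-- The cell of `E(X, d)` determined by the edge set of `f`. -/
def cellOf (f : X → ℝ) : Set (X → ℝ) := hull X ∩ (affH (edges f) : Set (X → ℝ))

/-- Hull membership reduces to the inequalities of `Delta X`, because the edges of `f` stay tight
for `g` and already cover `X`. -/
theorem mem_cellOf {f g : X → ℝ} (hf : f ∈ hull' X) :
    g ∈ cellOf f ↔ g ∈ Delta X ∧ ∀ x y, f x + f y = dist x y → g x + g y = dist x y := by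
  constructor
  · rintro ⟨h1, h2⟩
    exact ⟨hull_subset_Delta h1, fun x y hxy => h2 x y (mk_mem_edges.2 hxy)⟩
  · rintro ⟨h1, h2⟩
    refine ⟨hull'_subset_hull (mem_hull'_iff.2 ⟨h1, fun x => ?_⟩),
      fun x y hxy => h2 x y (mk_mem_edges.1 hxy)⟩
    obtain ⟨y, hy⟩ := (mem_hull'_iff.1 hf).2 x
    exact ⟨y, h2 x y hy⟩

theorem self_mem_cellOf {f : X → ℝ} (hf : f ∈ hull' X) : f ∈ cellOf f :=
  (mem_cellOf hf).2 ⟨hf.1, fun _ _ h => h⟩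

theorem mem_hull'_of_mem_cellOf {f g : X → ℝ} (hf : f ∈ hull' X) (hg : g ∈ cellOf f) :
    g ∈ hull' X := by
  obtain ⟨h1, h2⟩ := (mem_cellOf hf).1 hg
  refine mem_hull'_iff.2 ⟨h1, fun x => ?_⟩
  obtain ⟨y, hy⟩ := (mem_hull'_iff.1 hf).2 x
  exact ⟨y, h2 x y hy⟩

theorem convex_cellOf {f : X → ℝ} (hf : f ∈ hull' X) : Convex ℝ (cellOf f) := by
  intro g hg g' hg' a b ha hb hab
  rw [mem_cellOf hf] at *
  refine ⟨fun x y => ?_, fun x y hxy => ?_⟩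
  · have h1 := mul_le_mul_of_nonneg_left (hg.1 x y) ha
    have h2 := mul_le_mul_of_nonneg_left (hg'.1 x y) hb
    have h3 : dist x y = a * dist x y + b * dist x y := by rw [← add_mul, hab, one_mul]
    simp only [Pi.add_apply, Pi.smul_apply, smul_eq_mul]
    linarith
  · have h1 := hg.2 x y hxy
    have h2 := hg'.2 x y hxy
    simp only [Pi.add_apply, Pi.smul_apply, smul_eq_mul]
    linear_combination a * h1 + b * h2 + dist x y * hab

/-- A convex combination with positive weights makes an inequality tight only if both end points do.
-/
theorem isExtreme_cellOf {f g : X → ℝ} (hf : f ∈ hull' X) (hg : g ∈ cellOf f) :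
    IsExtreme ℝ (cellOf f) (cellOf g) := by
  have hg' := mem_hull'_of_mem_cellOf hf hg
  refine ⟨fun u hu => ?_, fun u hu v hv w hw huvw => ?_⟩
  · rw [mem_cellOf hg'] at hu
    exact (mem_cellOf hf).2 ⟨hu.1, fun x y h => hu.2 x y (((mem_cellOf hf).1 hg).2 x y h)⟩
  · rw [mem_cellOf hf] at hu hv
    rw [mem_cellOf hg'] at hw ⊢
    obtain ⟨a, b, ha, hb, hab, rfl⟩ := huvw
    refine ⟨hu.1, fun x y hxy => ?_⟩
    have h1 := hw.2 x y hxy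
    simp only [Pi.add_apply, Pi.smul_apply, smul_eq_mul] at h1
    have h2 := mul_le_mul_of_nonneg_left (hv.1 x y) hb.le
    have h3 : a * (u x + u y) ≤ a * dist x y := by
      have : dist x y = a * dist x y + b * dist x y := by rw [← add_mul, hab, one_mul]
      linarith
    exact le_antisymm (le_of_mul_le_mul_left h3 ha) (hu.1 x y)

/-- Helly property of the neighbourhoods of `x` in three edge graphs. -/
theorem exists_common_edge (h : TotallySplitDecomposable X) {g₁ g₂ g₃ : X → ℝ}
    (h₁ : g₁ ∈ hull' X) (h₂ : g₂ ∈ hull' X) (h₃ : g₃ ∈ hull' X) {x : X}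
    (h₁₂ : ∃ y, g₁ x + g₁ y = dist x y ∧ g₂ x + g₂ y = dist x y)
    (h₁₃ : ∃ y, g₁ x + g₁ y = dist x y ∧ g₃ x + g₃ y = dist x y)
    (h₂₃ : ∃ y, g₂ x + g₂ y = dist x y ∧ g₃ x + g₃ y = dist x y) :
    ∃ y, g₁ x + g₁ y = dist x y ∧ g₂ x + g₂ y = dist x y ∧ g₃ x + g₃ y = dist x y := by
  obtain ⟨y₃, a₁, a₂⟩ := h₁₂
  obtain ⟨y₂, b₁, b₃⟩ := h₁₃
  obtain ⟨y₁, c₂, c₃⟩ := h₂₃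
  by_contra! hcon
  obtain ⟨w₁, hw₁⟩ := (mem_hull'_iff.1 h₁).2 y₁
  obtain ⟨w₂, hw₂⟩ := (mem_hull'_iff.1 h₂).2 y₂
  obtain ⟨w₃, hw₃⟩ := (mem_hull'_iff.1 h₃).2 y₃
  -- If no `yᵢ` is a neighbour of `x` for its own `gᵢ`, each pairing sum of `x, y₁, y₂, y₃` is
  -- strictly below the larger of the other two.
  have k₁ := dist_add_dist_lt_max_of_not_edge h h₁.1 b₁ a₁ hw₁ fun e => hcon y₁ e c₂ c₃
  have k₂ := dist_add_dist_lt_max_of_not_edge h h₂.1 c₂ a₂ hw₂ fun e => hcon y₂ b₁ e b₃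
  have k₃ := dist_add_dist_lt_max_of_not_edge h h₃.1 c₃ b₃ hw₃ fun e => hcon y₃ a₁ a₂ e
  rw [lt_max_iff] at k₁ k₂ k₃
  have e1 := dist_comm y₂ y₁
  have e2 := dist_comm y₃ y₁
  have e3 := dist_comm y₃ y₂
  rcases k₁ with k₁ | k₁ <;> rcases k₂ with k₂ | k₂ <;> rcases k₃ with k₃ | k₃ <;> linarith

/-! ### Uniform slack and relatively interior points. -/

/-- In an integral metric space of locally finite rank, `f ∈ E'` takes finitely many values
modulo `1`. -/
theorem finite_range_fract (hint : IntegerValued X) {f : X → ℝ} (hf : f ∈ hull' X) {N : ℕ}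
    (hN : rk (edges f) ≤ N) : (Set.range fun x => Int.fract (f x)).Finite := by
  have key : ∀ x y, f x + f y = dist x y → Int.fract (f x) ≠ 0 →
      Int.fract (f y) = 1 - Int.fract (f x) := by
    intro x y hxy h0
    obtain ⟨n, hn⟩ := hint x y
    have : f y = -f x + n := by linarith
    rw [this, Int.fract_add_intCast, Int.fract_neg h0]
  have key0 : ∀ x y, f x + f y = dist x y → Int.fract (f x) = 0 → Int.fract (f y) = 0 := by
    intro x y hxy h0
    obtain ⟨n, hn⟩ := hint x y
    have : f y = -f x + n := by linarith
    rw [this, Int.fract_add_intCast, Int.fract_neg_eq_zero.2 h0]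
  -- An edge pairs fractional part `c` with `1 - c`, so raising the class of `c` and lowering that
  -- of `1 - c` keeps every edge tight. Taking `c < 1/2` makes the supports of these directions
  -- disjoint. The self-paired values `0` and `1/2` are added at the end.
  set U : Set ℝ := {c | 0 < c ∧ c < 1 / 2 ∧ ∃ x, Int.fract (f x) = c}
  classical
  let v : U → X → ℝ := fun c x =>
    (if Int.fract (f x) = c then 1 else 0) - (if Int.fract (f x) = 1 - c then 1 else 0)
  have hv : ∀ c : U, v c ∈ (affH (edges f)).direction := by
    intro c
    have hmem : f ∈ affH (edges f) := fun x y hxy => mk_mem_edges.1 hxy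
    have : f + v c ∈ affH (edges f) := by
      intro x y hxy
      have hxy := mk_mem_edges.1 hxy
      obtain ⟨c, hc0, hc1, -⟩ := c
      have hz : v ⟨c, hc0, hc1, ‹_›⟩ x + v ⟨c, hc0, hc1, ‹_›⟩ y = 0 := by
        simp only [v]
        by_cases h0 : Int.fract (f x) = 0
        · rw [h0, key0 x y hxy h0]
          split_ifs <;> linarith
        · rw [key x y hxy h0]
          split_ifs <;> first | linarith | (exfalso; grind)
      simp only [Pi.add_apply]
      linarith
    have h2 := AffineSubspace.vsub_mem_direction this hmem
    simpa using h2
  have hli : LinearIndependent ℝ v := by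
    rw [linearIndependent_iff']
    intro s w hw c hc
    obtain ⟨x, hx⟩ := c.2.2.2
    have hx' := congrFun hw x
    simp only [Finset.sum_apply, Pi.smul_apply, smul_eq_mul, Pi.zero_apply] at hx'
    rw [Finset.sum_eq_single_of_mem c hc] at hx'
    · have h1 : v c x = 1 := by
        simp only [v, hx]
        have := c.2.2.1
        rw [if_pos trivial, if_neg (by linarith)]
        norm_num
      simpa [h1] using hx'
    · intro b _ hb
      have h1 : v b x = 0 := by
        simp only [v, hx]
        have := c.2.2.1
        have := b.2.2.1
        rw [if_neg (fun h => hb (Subtype.ext h.symm)), if_neg (by linarith)]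
        norm_num
      rw [h1, mul_zero]
  have hUfin : U.Finite := by
    have hli' : LinearIndependent ℝ (fun c => (⟨v c, hv c⟩ : (affH (edges f)).direction)) :=
      LinearIndependent.of_comp (affH (edges f)).direction.subtype hli
    have h1 := hli'.cardinal_lift_le_rank
    have h2 : Cardinal.mk U < Cardinal.aleph0 := by
      have h3 : Cardinal.lift (Cardinal.mk U) < Cardinal.aleph0 :=
        lt_of_le_of_lt (h1.trans (Cardinal.lift_le.2 hN)) (by simp)
      simpa using h3
    exact Cardinal.lt_aleph0_iff_set_finite.1 h2
  refine ((hUfin.union (hUfin.image fun c => 1 - c)).union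
    (Set.toFinite ({0, 1 / 2} : Set ℝ))).subset ?_
  rintro _ ⟨x, rfl⟩
  simp only [Set.mem_union, Set.mem_image, Set.mem_insert_iff, Set.mem_singleton_iff]
  have hx0 := Int.fract_nonneg (f x)
  have hx1 := Int.fract_lt_one (f x)
  by_cases h0 : Int.fract (f x) = 0
  · simp [h0]
  have h0' : 0 < Int.fract (f x) := lt_of_le_of_ne hx0 (Ne.symm h0)
  rcases lt_trichotomy (Int.fract (f x)) (1 / 2) with h | h | h
  · exact Or.inl (Or.inl ⟨h0', h, x, rfl⟩)
  · exact Or.inr (Or.inr h)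
  · obtain ⟨y, hy⟩ := (mem_hull'_iff.1 hf).2 x
    have := key x y hy h0
    exact Or.inl (Or.inr ⟨_, ⟨by linarith, by linarith, y, this⟩, by ring⟩)

/-- Distances being integers, the fractional part of a slack depends only on those of `f x` and `f
y`, hence takes finitely many values. If it is `0`, a positive slack is at least `1`. -/
theorem exists_slack_gap (hint : IntegerValued X) {f : X → ℝ} (hf : f ∈ hull' X) {N : ℕ}
    (hN : rk (edges f) ≤ N) :
    ∃ ε > 0, ∀ x y, f x + f y ≠ dist x y → ε ≤ f x + f y - dist x y := by
  have hfin := finite_range_fract hint hf hN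
  set R := Set.range fun x => Int.fract (f x)
  have hT : ((fun p : ℝ × ℝ => Int.fract (p.1 + p.2)) '' (R ×ˢ R) ∩ Set.Ioi 0).Finite :=
    ((hfin.prod hfin).image _).inter_of_left _
  have hmem : ∀ x y, Int.fract (f x + f y - dist x y) ∈
      (fun p : ℝ × ℝ => Int.fract (p.1 + p.2)) '' (R ×ˢ R) := by
    intro x y
    refine ⟨(Int.fract (f x), Int.fract (f y)), ⟨⟨x, rfl⟩, ⟨y, rfl⟩⟩, ?_⟩
    obtain ⟨n, hn⟩ := hint x y
    rw [Int.fract_eq_fract, hn]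
    exact ⟨-⌊f x⌋ - ⌊f y⌋ + n, by simp only [Int.fract]; push_cast; ring⟩
  obtain ⟨ε, hε, hle⟩ : ∃ ε > 0, ∀ t ∈ (fun p : ℝ × ℝ => Int.fract (p.1 + p.2)) '' (R ×ˢ R) ∩
      Set.Ioi 0, ε ≤ t := by
    rcases Set.eq_empty_or_nonempty
      ((fun p : ℝ × ℝ => Int.fract (p.1 + p.2)) '' (R ×ˢ R) ∩ Set.Ioi 0) with he | hne
    · exact ⟨1, one_pos, by simp [he]⟩
    · obtain ⟨m, hm, hmin⟩ := hT.exists_minimal hne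
      exact ⟨m, hm.2, fun t ht => (le_total m t).elim id fun h => hmin ht h⟩
  refine ⟨min ε 1, lt_min hε one_pos, fun x y hxy => ?_⟩
  have hpos : 0 < f x + f y - dist x y :=
    sub_pos.2 (lt_of_le_of_ne (hf.1 x y) hxy.symm)
  rcases eq_or_ne (Int.fract (f x + f y - dist x y)) 0 with h0 | h0
  · obtain ⟨n, hn⟩ := Int.fract_eq_zero_iff.1 h0
    rw [← hn] at hpos ⊢
    have : (1 : ℤ) ≤ n := by exact_mod_cast hpos
    exact (min_le_right _ _).trans (by exact_mod_cast this)
  · refine (min_le_left _ _).trans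
      ((hle _ ⟨hmem x y, lt_of_le_of_ne (Int.fract_nonneg _) h0.symm⟩).trans ?_)
    have := Int.floor_nonneg.2 hpos.le
    have h2 : (0 : ℝ) ≤ ⌊f x + f y - dist x y⌋ := by exact_mod_cast this
    linarith [Int.floor_add_fract (f x + f y - dist x y)]

/-- Comparing through a base point `z` bounds the difference even when `f` and `g` are unbounded. -/
theorem exists_abs_sub_le {f g : X → ℝ} (hf : f ∈ hull' X) (hg : g ∈ hull' X) :
    ∃ M, 0 ≤ M ∧ ∀ x, |f x - g x| ≤ M := by
  rcases isEmpty_or_nonempty X with _ | ⟨⟨z⟩⟩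
  · exact ⟨0, le_rfl, fun x => isEmptyElim x⟩
  have key : ∀ f ∈ hull' X, ∀ g ∈ hull' X, ∀ x, f x - g x ≤ f z + g z := by
    intro f hf g hg x
    obtain ⟨y, hy⟩ := (mem_hull'_iff.1 hf).2 x
    linarith [dist_triangle x z y, hf.1 z y, hg.1 x z]
  have hM : ∀ x, |f x - g x| ≤ f z + g z := fun x =>
    abs_le.2 ⟨by linarith [key g hg f hf x], key f hf g hg x⟩
  exact ⟨_, (abs_nonneg _).trans (hM z), hM⟩

theorem LocalRankCondition.exists_rk_le (h : LocalRankCondition X) {f : X → ℝ}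
    (hf : f ∈ hull' X) : ∃ N : ℕ, rk (edges f) ≤ N := by
  obtain ⟨ε, hε, N, hN⟩ := h f (hull'_subset_hull hf)
  exact ⟨N, hN f hf ⟨0, hε, by simp⟩⟩

/-- `f` is a relatively interior point of its cell. -/
theorem eq_cellOf_of_isExtreme (hint : IntegerValued X) (hlrc : LocalRankCondition X)
    {f : X → ℝ} (hf : f ∈ hull' X) {F : Set (X → ℝ)} (hF : IsExtreme ℝ (cellOf f) F)
    (hfF : f ∈ F) : F = cellOf f := by
  refine hF.subset.antisymm fun g hg => ?_
  obtain ⟨N, hN⟩ := hlrc.exists_rk_le hf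
  obtain ⟨ε, hε, hgap⟩ := exists_slack_gap hint hf hN
  obtain ⟨M, hM0, hM⟩ := exists_abs_sub_le hf (mem_hull'_of_mem_cellOf hf hg)
  have hg2 := (mem_cellOf hf).1 hg
  -- Prolonging from `g` past `f` by `t` lowers each slack by at most `2 * M * t ≤ ε`; the `+ 1`
  -- covers `M = 0`.
  set t := ε / (2 * M + 1) with ht
  have ht0 : 0 < t := by positivity
  have htM : t * (2 * M) ≤ ε := by
    rw [ht, div_mul_eq_mul_div, div_le_iff₀ (by positivity)]
    nlinarith
  have hmem : f + t • (f - g) ∈ cellOf f := by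
    have heq : ∀ x y, f x + f y = dist x y →
        (f + t • (f - g)) x + (f + t • (f - g)) y = dist x y := by
      intro x y hxy
      have := hg2.2 x y hxy
      simp only [Pi.add_apply, Pi.smul_apply, Pi.sub_apply, smul_eq_mul]
      linear_combination (1 + t) * hxy - t * this
    refine (mem_cellOf hf).2 ⟨fun x y => ?_, heq⟩
    by_cases hxy : f x + f y = dist x y
    · exact (heq x y hxy).ge
    · have h1 := hgap x y hxy
      have h2 := (abs_le.1 (hM x)).1
      have h3 := (abs_le.1 (hM y)).1
      have h4 : t * (-(2 * M)) ≤ t * ((f x - g x) + (f y - g y)) :=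
        mul_le_mul_of_nonneg_left (by linarith) ht0.le
      simp only [Pi.add_apply, Pi.smul_apply, Pi.sub_apply, smul_eq_mul]
      linarith
  refine hF.left_mem_of_mem_openSegment hg hmem hfF
    ⟨t / (1 + t), 1 / (1 + t), by positivity, by positivity, by field_simp; ring, ?_⟩
  ext x
  simp only [Pi.add_apply, Pi.smul_apply, Pi.sub_apply, smul_eq_mul]
  field_simp
  ring

end Cells

end InjHull

namespace InjHull

/-! ### Faces, facets and dimensions of polytopes. -/

section Polytopes

open Module

variable {V W : Type*} [AddCommGroup V] [Module ℝ V] [AddCommGroup W] [Module ℝ W]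

/-- A convex polytope. -/
def IsPolytope (P : Set V) : Prop := ∃ s : Finset V, P = convexHull ℝ (s : Set V)

theorem vectorSpan_convexHull (s : Set V) : vectorSpan ℝ (convexHull ℝ s) = vectorSpan ℝ s := by
  rw [← direction_affineSpan, affineSpan_convexHull, direction_affineSpan]

theorem IsPolytope.finiteDimensional {P : Set V} (hP : IsPolytope P) :
    FiniteDimensional ℝ (vectorSpan ℝ P) := by
  obtain ⟨s, rfl⟩ := hP
  rw [vectorSpan_convexHull]
  exact finiteDimensional_vectorSpan_of_finite ℝ s.finite_toSet

theorem IsPolytope.convex {P : Set V} (hP : IsPolytope P) : Convex ℝ P := by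
  obtain ⟨s, rfl⟩ := hP
  exact convex_convexHull ℝ _

theorem cellDim_eq_natCast_iff {P : Set V} (hP : IsPolytope P) {k : ℕ} :
    cellDim P = k ↔ finrank ℝ (vectorSpan ℝ P) = k := by
  have := hP.finiteDimensional
  rw [cellDim, ← finrank_eq_rank, Nat.cast_inj]

/-- In a convex combination representing a point of `F`, every generator of positive weight lies in
`F`: the point is strictly between that generator and the centre of mass of the others, unless it is
the generator itself. -/
theorem IsPolytope.of_isExtreme {P F : Set V} (hP : IsPolytope P) (hF : Convex ℝ F)
    (hPF : IsExtreme ℝ P F) : IsPolytope F := by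
  classical
  obtain ⟨s, rfl⟩ := hP
  refine ⟨s.filter (· ∈ F), subset_antisymm (fun x hx => ?_)
    (convexHull_min (fun v hv => (Finset.mem_filter.1 hv).2) hF)⟩
  obtain ⟨w, hw0, hw1, hwx⟩ := Finset.mem_convexHull'.1 (hPF.subset hx)
  have hmem : ∀ v ∈ s, w v ≠ 0 → v ∈ F := by
    intro v hv hwv
    have hpos : 0 < w v := lt_of_le_of_ne (hw0 v hv) hwv.symm
    have hsum := Finset.add_sum_erase s w hv
    have hsum' := Finset.add_sum_erase s (fun y => w y • y) hv
    have hr : 0 ≤ ∑ y ∈ s.erase v, w y :=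
      Finset.sum_nonneg fun y hy => hw0 y (Finset.mem_of_mem_erase hy)
    rcases hr.eq_or_lt with hr | hr
    · have hz := (Finset.sum_eq_zero_iff_of_nonneg
        fun y hy => hw0 y (Finset.mem_of_mem_erase hy)).1 hr.symm
      have h1 : w v = 1 := by linarith
      have : ∑ y ∈ s.erase v, w y • y = 0 :=
        Finset.sum_eq_zero fun y hy => by rw [hz y hy, zero_smul]
      simp only [this, h1, one_smul, add_zero, hwx] at hsum'
      rwa [hsum']
    · refine hPF.left_mem_of_mem_openSegment (subset_convexHull ℝ _ hv)
        (Finset.centerMass_mem_convexHull (s.erase v) (w := w) (z := id)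
          (fun y hy => hw0 y (Finset.mem_of_mem_erase hy)) hr
          fun y hy => Finset.mem_of_mem_erase hy) hx
        ⟨w v, ∑ y ∈ s.erase v, w y, hpos, hr, by linarith, ?_⟩
      rw [Finset.centerMass, smul_smul, mul_inv_cancel₀ hr.ne', one_smul]
      simpa [hwx] using hsum'
  refine Finset.mem_convexHull'.2 ⟨w, fun y hy => hw0 y (Finset.mem_of_mem_filter y hy), ?_, ?_⟩
  · rw [← hw1]
    refine Finset.sum_filter_of_ne fun v hv h => hmem v hv h
  · rw [← hwx]
    refine Finset.sum_filter_of_ne fun v hv h => hmem v hv fun h0 => h (by rw [h0, zero_smul])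

/-- A non-empty polytope has a point that can be prolonged in all directions of its affine
span. -/
theorem IsPolytope.exists_center {P : Set V} (hP : IsPolytope P) (hne : P.Nonempty) :
    ∃ p ∈ P, ∀ g ∈ affineSpan ℝ P, ∃ ε > (0 : ℝ), p + ε • (p - g) ∈ P := by
  classical
  obtain ⟨s, rfl⟩ := hP
  have hs : s.Nonempty := by simpa using hne
  have hc : (0 : ℝ) < s.card := by exact_mod_cast hs.card_pos
  have hp1 : ∑ y ∈ s, (s.card : ℝ)⁻¹ = 1 := by
    rw [Finset.sum_const, nsmul_eq_mul, mul_inv_cancel₀ hc.ne']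
  refine ⟨∑ y ∈ s, (s.card : ℝ)⁻¹ • y, Finset.mem_convexHull'.2
    ⟨fun _ => (s.card : ℝ)⁻¹, fun _ _ => by positivity, hp1, rfl⟩, fun g hg => ?_⟩
  rw [affineSpan_convexHull] at hg
  obtain ⟨w, hw1, hwg⟩ : ∃ w : V → ℝ, ∑ y ∈ s, w y = 1 ∧ ∑ y ∈ s, w y • y = g := by
    have : (s : Set V) = Set.range (fun y : s => (y : V)) := by simp
    rw [this] at hg
    obtain ⟨w, hw1, hwg⟩ := eq_affineCombination_of_mem_affineSpan_of_fintype hg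
    refine ⟨fun v => if h : v ∈ s then w ⟨v, h⟩ else 0, ?_, ?_⟩
    · rw [← hw1, ← Finset.sum_coe_sort s]
      exact Finset.sum_congr rfl fun y _ => by simp
    · rw [hwg, Finset.affineCombination_eq_linear_combination _ _ _ hw1, ← Finset.sum_coe_sort s]
      exact Finset.sum_congr rfl fun y _ => by simp
  obtain ⟨B, hB⟩ : ∃ B, ∀ y ∈ s, w y ≤ B := by
    obtain ⟨B, hB⟩ := (s.image w).bddAbove
    exact ⟨B, fun y hy => hB (by exact_mod_cast Finset.mem_image_of_mem w hy)⟩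
  -- The barycentre gives every generator weight `1 / s.card`, leaving room to subtract `ε` times
  -- the weights of `g`, which are at most `B`.
  refine ⟨(s.card : ℝ)⁻¹ / (|B| + 1), by positivity, ?_⟩
  set ε := (s.card : ℝ)⁻¹ / (|B| + 1) with hε
  have hε0 : 0 < ε := by positivity
  refine Finset.mem_convexHull'.2
    ⟨fun y => (s.card : ℝ)⁻¹ + ε * ((s.card : ℝ)⁻¹ - w y), fun y hy => ?_, ?_, ?_⟩
  · have h1 : ε * w y ≤ ε * (|B| + 1) :=
      mul_le_mul_of_nonneg_left (by linarith [hB y hy, le_abs_self B]) hε0.le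
    have h2 : ε * (|B| + 1) = (s.card : ℝ)⁻¹ := by
      rw [hε]; field_simp
    have h3 : 0 < ε * (s.card : ℝ)⁻¹ := by positivity
    linarith
  · rw [Finset.sum_add_distrib, ← Finset.mul_sum, Finset.sum_sub_distrib, hp1, hw1]
    ring
  · simp only [add_smul, mul_smul, sub_smul, Finset.sum_add_distrib, ← Finset.smul_sum,
      Finset.sum_sub_distrib, hwg]

/-- With equal spans, a segment from any `g ∈ P` through the centre of `F` could be prolonged inside
`F`, and extremeness would give `g ∈ F`. -/
theorem finrank_lt_of_isExtreme {P F : Set V} (hP : IsPolytope P) (hF : Convex ℝ F)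
    (hPF : IsExtreme ℝ P F) (hne : F.Nonempty) (hFP : F ≠ P) :
    finrank ℝ (vectorSpan ℝ F) < finrank ℝ (vectorSpan ℝ P) := by
  have := hP.finiteDimensional
  refine Submodule.finrank_lt_finrank_of_lt (lt_of_le_of_ne (vectorSpan_mono ℝ hPF.subset) ?_)
  intro heq
  refine hFP (hPF.subset.antisymm fun g hg => ?_)
  obtain ⟨p, hp, hext⟩ := (hP.of_isExtreme hF hPF).exists_center hne
  have hgF : g ∈ affineSpan ℝ F := by
    have hd : g -ᵥ p ∈ (affineSpan ℝ F).direction := by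
      rw [direction_affineSpan, heq]
      exact vsub_mem_vectorSpan ℝ hg (hPF.subset hp)
    have := AffineSubspace.vadd_mem_of_mem_direction hd (mem_affineSpan ℝ hp)
    simpa using this
  obtain ⟨ε, hε, hq⟩ := hext g hgF
  refine hPF.left_mem_of_mem_openSegment hg (hPF.subset hq) hp
    ⟨ε / (1 + ε), 1 / (1 + ε), by positivity, by positivity, by field_simp; ring, ?_⟩
  have h1 : (1 / (1 + ε)) + (1 / (1 + ε)) * ε = 1 := by field_simp
  have h2 : ε / (1 + ε) = (1 / (1 + ε)) * ε := by field_simp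
  rw [smul_add, smul_smul, smul_sub, h2]
  calc _ = (1 / (1 + ε) + 1 / (1 + ε) * ε) • p := by rw [add_smul]; abel
    _ = p := by rw [h1, one_smul]

/-- The face of `P` on which a linear functional attains an upper bound. -/
theorem isExtreme_sep_eq {P : Set V} {φ : V →ₗ[ℝ] ℝ} {c : ℝ} (h : ∀ x ∈ P, φ x ≤ c) :
    IsExtreme ℝ P {x ∈ P | φ x = c} := by
  refine ⟨fun x hx => hx.1, fun x hx y hy z hz hxyz => ⟨hx, ?_⟩⟩
  obtain ⟨a, b, ha, hb, hab, rfl⟩ := hxyz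
  have h1 := hz.2
  simp only [map_add, map_smul, smul_eq_mul] at h1
  have h2 := mul_le_mul_of_nonneg_left (h y hy) hb.le
  refine le_antisymm (h x hx) (le_of_mul_le_mul_left (a := a) ?_ ha)
  have : c = a * c + b * c := by rw [← add_mul, hab, one_mul]
  linarith

theorem convex_sep_eq {P : Set V} (hP : Convex ℝ P) (φ : V →ₗ[ℝ] ℝ) (c : ℝ) :
    Convex ℝ {x ∈ P | φ x = c} := by
  refine hP.inter fun x hx y hy a b _ _ hab => ?_
  change φ (a • x + b • y) = c
  rw [map_add, map_smul, map_smul, show φ x = c from hx, show φ y = c from hy, ← add_smul, hab,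
    one_smul]

/-- If a supporting hyperplane of `s` touches it in codimension at least two, then it can be
rotated to touch `s` in more points. -/
theorem exists_larger_support {s : Finset V} {φ : V →ₗ[ℝ] ℝ} {c : ℝ}
    (hle : ∀ x ∈ s, φ x ≤ c) {v₀ : V} (hv₀ : v₀ ∈ s) (hv₀c : φ v₀ = c)
    (hdim : finrank ℝ (vectorSpan ℝ {x | x ∈ s ∧ φ x = c}) + 1
      < finrank ℝ (vectorSpan ℝ (s : Set V))) :
    ∃ (ψ : V →ₗ[ℝ] ℝ) (e : ℝ), (∀ x ∈ s, ψ x ≤ e) ∧ (∃ x ∈ s, ψ x ≠ e) ∧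
      (∀ x ∈ s, φ x = c → ψ x = e) ∧ ∃ x ∈ s, ψ x = e ∧ φ x ≠ c := by
  classical
  set L := vectorSpan ℝ {x | x ∈ s ∧ φ x = c}
  have : FiniteDimensional ℝ (vectorSpan ℝ (s : Set V)) :=
    finiteDimensional_vectorSpan_of_finite ℝ s.finite_toSet
  have : FiniteDimensional ℝ L :=
    finiteDimensional_vectorSpan_of_finite ℝ (s.finite_toSet.subset fun x hx => hx.1)
  -- The kernel of `φ` has codimension at most one in the span of `s`, while `L` has codimension at
  -- least two.
  obtain ⟨u, hu, huφ, huL⟩ : ∃ u ∈ vectorSpan ℝ (s : Set V), φ u = 0 ∧ u ∉ L := by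
    by_contra! hcon
    have h1 := (φ.domRestrict (vectorSpan ℝ (s : Set V))).finrank_range_add_finrank_ker
    have h2 : finrank ℝ (LinearMap.range (φ.domRestrict (vectorSpan ℝ (s : Set V)))) ≤ 1 :=
      (Submodule.finrank_le _).trans (by simp)
    have h3 : finrank ℝ (LinearMap.ker (φ.domRestrict (vectorSpan ℝ (s : Set V)))) ≤
        finrank ℝ L := by
      rw [← Submodule.finrank_map_subtype_eq]
      refine Submodule.finrank_mono ?_
      rintro _ ⟨x, hx, rfl⟩
      exact hcon x x.2 (by simpa using hx)
    omega
  obtain ⟨l, hlu, hlL⟩ : ∃ l : V →ₗ[ℝ] ℝ, l u ≠ 0 ∧ ∀ x ∈ L, l x = 0 := by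
    obtain ⟨l, hlu, hl⟩ := Submodule.exists_dual_map_eq_bot_of_notMem huL inferInstance
    refine ⟨l, hlu, fun x hx => ?_⟩
    have : l x ∈ L.map l := ⟨x, hx, rfl⟩
    rwa [hl, Submodule.mem_bot] at this
  have hspan : ∀ ψ : V →ₗ[ℝ] ℝ, ∀ e : ℝ, (∀ x ∈ s, ψ x = e) → ψ u = 0 := by
    intro ψ e h
    have : vectorSpan ℝ (s : Set V) ≤ LinearMap.ker ψ := by
      rw [vectorSpan_def, Submodule.span_le]
      rintro _ ⟨x, hx, y, hy, rfl⟩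
      simp [h x hx, h y hy]
    exact this hu
  obtain ⟨l, hlu, hlL, p, hp, hpl⟩ : ∃ l : V →ₗ[ℝ] ℝ, l u ≠ 0 ∧ (∀ x ∈ L, l x = 0) ∧
      ∃ p ∈ s, l v₀ < l p := by
    by_contra! hcon
    refine hlu (hspan l (l v₀) fun x hx => le_antisymm (hcon l hlu hlL x hx) ?_)
    simpa using hcon (-l) (by simpa using hlu) (fun y hy => by simpa using hlL y hy) x hx
  have hlF : ∀ x ∈ s, φ x = c → l x = l v₀ := by
    intro x hx hxc
    have := hlL _ (vsub_mem_vectorSpan ℝ (show x ∈ {x | x ∈ s ∧ φ x = c} from ⟨hx, hxc⟩)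
      (show v₀ ∈ {x | x ∈ s ∧ φ x = c} from ⟨hv₀, hv₀c⟩))
    simpa [sub_eq_zero] using this
  -- Tilting `φ` by `t • l` keeps the old contact points; the least ratio is the first `t` at which
  -- a new generator is reached.
  obtain ⟨q, hq, hqmin⟩ := Finset.exists_min_image (s.filter fun x => l v₀ < l x)
    (fun x => (c - φ x) / (l x - l v₀)) ⟨p, Finset.mem_filter.2 ⟨hp, hpl⟩⟩
  obtain ⟨hqs, hql⟩ := Finset.mem_filter.1 hq
  have hqc : φ q ≠ c := fun h => hql.ne' (hlF q hqs h)
  set t := (c - φ q) / (l q - l v₀) with ht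
  have ht0 : 0 < t :=
    div_pos (sub_pos.2 (lt_of_le_of_ne (hle q hqs) hqc)) (sub_pos.2 hql)
  have hval : ∀ x, (φ + t • l) x = φ x + t * l x := fun x => by simp
  refine ⟨φ + t • l, c + t * l v₀, fun x hx => ?_, ?_, fun x hx hxc => ?_, q, hqs, ?_, hqc⟩
  · rw [hval]
    rcases le_or_gt (l x) (l v₀) with h | h
    · have := mul_le_mul_of_nonneg_left h ht0.le
      linarith [hle x hx]
    · have h1 := hqmin x (Finset.mem_filter.2 ⟨hx, h⟩)
      rw [le_div_iff₀ (sub_pos.2 h)] at h1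
      linarith
  · by_contra! hcon
    have := hspan _ _ hcon
    rw [hval, huφ, zero_add] at this
    exact (mul_ne_zero ht0.ne' hlu) this
  · rw [hval, hxc, hlF x hx hxc]
  · have : t * (l q - l v₀) = c - φ q := div_mul_cancel₀ _ (sub_pos.2 hql).ne'
    rw [hval]
    linarith

/-- A polytope of positive dimension has a facet. -/
theorem IsPolytope.exists_facet {P : Set V} (hP : IsPolytope P)
    (hdim : 0 < finrank ℝ (vectorSpan ℝ P)) :
    ∃ F, Convex ℝ F ∧ IsExtreme ℝ P F ∧ F.Nonempty ∧ F ≠ P ∧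
      finrank ℝ (vectorSpan ℝ P) ≤ finrank ℝ (vectorSpan ℝ F) + 1 := by
  classical
  obtain ⟨s, rfl⟩ := hP
  rw [vectorSpan_convexHull] at hdim ⊢
  -- A proper supporting hyperplane with the most generators on it cuts out a facet; otherwise
  -- `exists_larger_support` would improve it.
  let T : Set ℕ := {n | ∃ (φ : V →ₗ[ℝ] ℝ) (c : ℝ), (∀ x ∈ s, φ x ≤ c) ∧ (∃ x ∈ s, φ x ≠ c) ∧
    (∃ x ∈ s, φ x = c) ∧ n = (s.filter fun x => φ x = c).card}
  have hTne : T.Nonempty := by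
    have : (s : Set V).Nontrivial := by
      by_contra h
      rw [Set.not_nontrivial_iff] at h
      rw [vectorSpan_of_subsingleton ℝ h] at hdim
      simp at hdim
    obtain ⟨a, ha, b, hb, hab⟩ := this
    obtain ⟨φ, hφ⟩ : ∃ φ : V →ₗ[ℝ] ℝ, φ (a - b) ≠ 0 := by
      by_contra! h
      exact hab (sub_eq_zero.1 ((Module.forall_dual_apply_eq_zero_iff ℝ _).1 h))
    obtain ⟨q, hq, hmax⟩ := s.exists_max_image φ ⟨a, ha⟩
    refine ⟨_, φ, φ q, hmax, ?_, ⟨q, hq, rfl⟩, rfl⟩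
    by_contra! h
    exact hφ (by rw [map_sub, h a ha, h b hb, sub_self])
  have hTb : BddAbove T := ⟨s.card, by
    rintro n ⟨φ, c, -, -, -, rfl⟩
    exact Finset.card_filter_le _ _⟩
  obtain ⟨φ, c, hle, ⟨y, hy, hyc⟩, ⟨v₀, hv₀, hv₀c⟩, hcard⟩ := Nat.sSup_mem hTne hTb
  have hleP : ∀ x ∈ convexHull ℝ (s : Set V), φ x ≤ c :=
    fun x hx => convexHull_min (t := {x | φ x ≤ c}) hle (convex_halfSpace_le φ.isLinear c) hx
  refine ⟨{x ∈ convexHull ℝ (s : Set V) | φ x = c}, convex_sep_eq (convex_convexHull ℝ _) φ c,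
    isExtreme_sep_eq hleP, ⟨v₀, subset_convexHull ℝ _ hv₀, hv₀c⟩, fun h => ?_, ?_⟩
  · have : y ∈ {x ∈ convexHull ℝ (s : Set V) | φ x = c} := by
      rw [h]; exact subset_convexHull ℝ _ hy
    exact hyc this.2
  · by_contra! hlt
    have hsub : vectorSpan ℝ {x | x ∈ s ∧ φ x = c} ≤
        vectorSpan ℝ {x ∈ convexHull ℝ (s : Set V) | φ x = c} :=
      vectorSpan_mono ℝ fun x hx => ⟨subset_convexHull ℝ _ hx.1, hx.2⟩
    have : FiniteDimensional ℝ
        (vectorSpan ℝ {x ∈ convexHull ℝ (s : Set V) | φ x = c}) :=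
      (IsPolytope.of_isExtreme ⟨s, rfl⟩ (convex_sep_eq (convex_convexHull ℝ _) φ c)
        (isExtreme_sep_eq hleP)).finiteDimensional
    obtain ⟨ψ, e, h1, h2, h3, q, hq, hqe, hqc⟩ := exists_larger_support hle hv₀ hv₀c
      (lt_of_le_of_lt (Nat.succ_le_succ (Submodule.finrank_mono hsub)) hlt)
    have hmem : (s.filter fun x => ψ x = e).card ∈ T :=
      ⟨ψ, e, h1, h2, ⟨q, hq, hqe⟩, rfl⟩
    have hle' := le_csSup hTb hmem
    rw [hcard] at hle'
    refine hle'.not_gt (Finset.card_lt_card ⟨fun x hx => ?_, fun h => ?_⟩)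
    · rw [Finset.mem_filter] at hx ⊢
      exact ⟨hx.1, h3 x hx.1 hx.2⟩
    · exact hqc (Finset.mem_filter.1 (h (Finset.mem_filter.2 ⟨hq, hqe⟩))).2

/-- A face of a face, as a face. -/
def Faces.ofFace {P : Set V} (F : Faces P) (G : Faces F.1) : Faces P :=
  ⟨G.1, G.2.1, F.2.2.trans G.2.2⟩

/-- The map between the faces of `F` and of `Φ F` induced by `Φ`. -/
def Faces.restrictMap {P : Set V} {Q : Set W} {Φ : Faces P → Faces Q} (hΦ : StrictMono Φ)
    (F : Faces P) (G : Faces F.1) : Faces (Φ F).1 :=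
  ⟨(Φ (F.ofFace G)).1, (Φ (F.ofFace G)).2.1, (Φ (F.ofFace G)).2.2.mono (Φ F).2.2.subset
    (hΦ.monotone (show F.ofFace G ≤ F from G.2.2.subset))⟩

theorem Faces.restrictMap_strictMono {P : Set V} {Q : Set W} {Φ : Faces P → Faces Q}
    (hΦ : StrictMono Φ) (F : Faces P) : StrictMono (Faces.restrictMap hΦ F) :=
  fun G G' h => hΦ (show F.ofFace G < F.ofFace G' from h)

theorem Faces.nonempty_map {P : Set V} {Q : Set W} {Φ : Faces P → Faces Q}
    (hΦ : StrictMono Φ) {F : Faces P} (hF : F.1.Nonempty) : (Φ F).1.Nonempty := by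
  let E : Faces P := ⟨∅, convex_empty, Set.empty_subset _, fun _ _ _ _ _ h => h.elim⟩
  have h : Φ E < Φ F := hΦ (show E.1 < F.1 from Set.empty_ssubset.2 hF)
  by_contra hne
  rw [Set.not_nonempty_iff_eq_empty] at hne
  have h' : (Φ E).1 < (Φ F).1 := h
  rw [hne] at h'
  exact h'.not_ge (Set.empty_subset _)

/-- Induction on dimension: passing to a facet loses at most one dimension in `P`, while its image,
a proper face, loses at least one in `Q`. -/
theorem finrank_le_of_strictMono {P : Set V} {Q : Set W} (hP : IsPolytope P)
    (hQ : IsPolytope Q) {Φ : Faces P → Faces Q} (hΦ : StrictMono Φ) :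
    finrank ℝ (vectorSpan ℝ P) ≤ finrank ℝ (vectorSpan ℝ Q) := by
  induction hn : finrank ℝ (vectorSpan ℝ P) using Nat.strong_induction_on generalizing P Q with
  | _ n ih =>
    rcases Nat.eq_zero_or_pos n with h0 | h0
    · omega
    obtain ⟨F, hFc, hFe, hFne, hFP, hdim⟩ := hP.exists_facet (by omega)
    let F' : Faces P := ⟨F, hFc, hFe⟩
    let P' : Faces P := ⟨P, hP.convex, IsExtreme.rfl⟩
    have hFlt := finrank_lt_of_isExtreme hP hFc hFe hFne hFP
    have hlt : Φ F' < Φ P' := hΦ (show F < P from lt_of_le_of_ne hFe.subset hFP)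
    have h1 := ih _ (by omega) (hP.of_isExtreme hFc hFe)
      (hQ.of_isExtreme (Φ F').2.1 (Φ F').2.2) (Faces.restrictMap_strictMono hΦ F') rfl
    have h2 := finrank_lt_of_isExtreme hQ (Φ F').2.1 (Φ F').2.2
      (Faces.nonempty_map hΦ (F := F') hFne)
      (fun h => hlt.not_ge (show (Φ P').1 ≤ (Φ F').1 by rw [h]; exact (Φ P').2.2.subset))
    omega

/-- Dimensions of faces are determined by the face lattice. -/
theorem finrank_orderIso_apply {P : Set V} {Q : Set W} (hP : IsPolytope P) (hQ : IsPolytope Q)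
    (Φ : Faces P ≃o Faces Q) (F : Faces P) :
    finrank ℝ (vectorSpan ℝ (Φ F).1) = finrank ℝ (vectorSpan ℝ F.1) := by
  refine le_antisymm ?_ ?_
  · have := finrank_le_of_strictMono (hQ.of_isExtreme (Φ F).2.1 (Φ F).2.2)
      (hP.of_isExtreme (Φ.symm (Φ F)).2.1 (Φ.symm (Φ F)).2.2)
      (Faces.restrictMap_strictMono Φ.symm.strictMono (Φ F))
    rwa [Φ.symm_apply_apply] at this
  · exact finrank_le_of_strictMono (hP.of_isExtreme F.2.1 F.2.2)
      (hQ.of_isExtreme (Φ F).2.1 (Φ F).2.2) (Faces.restrictMap_strictMono Φ.strictMono F)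

end Polytopes

end InjHull

namespace InjHull

/-! ### Faces of cubes. -/

section Cube

open Module

theorem isPolytope_Icc (n : ℕ) : IsPolytope (Set.Icc (0 : Fin n → ℝ) 1) := by
  classical
  refine ⟨Fintype.piFinset fun _ => {0, 1}, ?_⟩
  have h : ((Fintype.piFinset fun _ : Fin n => ({0, 1} : Finset ℝ)) : Set (Fin n → ℝ)) =
      Set.univ.pi fun _ => {0, 1} := by
    ext x; simp
  rw [h, convexHull_pi, ← Set.pi_univ_Icc]
  refine Set.pi_congr rfl fun i _ => ?_
  rw [convexHull_pair, segment_eq_Icc zero_le_one]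
  rfl

/-- A non-empty face of a cube is determined by its set of free coordinates. -/
theorem exists_free_coordinates {n : ℕ} {F : Set (Fin n → ℝ)} (hF : Convex ℝ F)
    (hFe : IsExtreme ℝ (Set.Icc 0 1) F) (hne : F.Nonempty) :
    ∃ J : Finset (Fin n), finrank ℝ (vectorSpan ℝ F) = J.card ∧
      (∀ v, v ∈ vectorSpan ℝ F ↔ ∀ i ∉ J, v i = 0) ∧ ∀ x ∈ F, ∀ i ∉ J, x i = 0 ∨ x i = 1 := by
  classical
  obtain ⟨p, hp, hext⟩ := ((isPolytope_Icc n).of_isExtreme hF hFe).exists_center hne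
  have hpc := hFe.subset hp
  have hp0 : ∀ i, 0 ≤ p i := fun i => hpc.1 i
  have hp1 : ∀ i, p i ≤ 1 := fun i => hpc.2 i
  let J : Finset (Fin n) := Finset.univ.filter fun i => 0 < p i ∧ p i < 1
  have hJ : ∀ i, i ∉ J → p i = 0 ∨ p i = 1 := by
    intro i hi
    simp only [J, Finset.mem_filter, Finset.mem_univ, true_and, not_and, not_lt] at hi
    rcases (hp0 i).eq_or_lt with h | h
    · exact Or.inl h.symm
    · exact Or.inr (le_antisymm (hp1 i) (hi h))
  -- A coordinate of the centre at `0` or `1` is constant on `F`, since prolonging past the centre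
  -- would otherwise leave the cube.
  have hconst : ∀ x ∈ F, ∀ i ∉ J, x i = p i := by
    intro x hx i hi
    obtain ⟨ε, hε, hq⟩ := hext x (mem_affineSpan ℝ hx)
    have h1 := (hFe.subset hx).1 i
    have h2 := (hFe.subset hx).2 i
    have h3 := (hFe.subset hq).1 i
    have h4 := (hFe.subset hq).2 i
    simp only [Pi.zero_apply, Pi.one_apply, Pi.add_apply, Pi.smul_apply, Pi.sub_apply,
      smul_eq_mul] at h1 h2 h3 h4
    rcases hJ i hi with h | h
    · rw [h] at h3 ⊢
      nlinarith
    · rw [h] at h4 ⊢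
      nlinarith
  have hsingle : ∀ i ∈ J, Pi.single i (1 : ℝ) ∈ vectorSpan ℝ F := by
    intro i hi
    obtain ⟨hi0, hi1⟩ := (Finset.mem_filter.1 hi).2
    set ε := min (p i) (1 - p i) with hε
    have hε0 : 0 < ε := lt_min hi0 (by linarith)
    have hεp : ε ≤ p i := min_le_left _ _
    have hεq : ε ≤ 1 - p i := min_le_right _ _
    have hcube : ∀ t : ℝ, |t| ≤ ε → p + t • Pi.single i (1 : ℝ) ∈ Set.Icc (0 : Fin n → ℝ) 1 := by
      intro t ht
      obtain ⟨ht1, ht2⟩ := abs_le.1 ht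
      refine ⟨fun j => ?_, fun j => ?_⟩ <;> rcases eq_or_ne j i with rfl | hj
      · simp; linarith
      · simpa [hj] using hp0 j
      · simp; linarith
      · simpa [hj] using hp1 j
    -- The centre is the midpoint of two cube points shifted by `±ε` along axis `i`, so both lie in
    -- the face.
    have hmem : p + ε • Pi.single i (1 : ℝ) ∈ F := by
      refine hFe.left_mem_of_mem_openSegment (hcube ε (abs_of_pos hε0).le)
        (hcube (-ε) (by rw [abs_neg, abs_of_pos hε0])) hp
        ⟨1 / 2, 1 / 2, by norm_num, by norm_num, by norm_num, ?_⟩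
      rw [neg_smul]
      module
    have := vsub_mem_vectorSpan ℝ hmem hp
    rw [vsub_eq_sub, add_sub_cancel_left] at this
    simpa [smul_smul, hε0.ne'] using Submodule.smul_mem _ ε⁻¹ this
  have hzero : ∀ v ∈ vectorSpan ℝ F, ∀ i ∉ J, v i = 0 := by
    intro v hv i hi
    have : vectorSpan ℝ F ≤ LinearMap.ker (LinearMap.proj i : (Fin n → ℝ) →ₗ[ℝ] ℝ) := by
      rw [vectorSpan_def, Submodule.span_le]
      rintro _ ⟨x, hx, y, hy, rfl⟩
      simp [hconst x hx i hi, hconst y hy i hi]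
    exact this hv
  have hspan : vectorSpan ℝ F =
      Submodule.span ℝ (Set.range fun i : J => (Pi.single (i : Fin n) (1 : ℝ) : Fin n → ℝ)) := by
    refine le_antisymm (fun v hv => ?_) (Submodule.span_le.2 ?_)
    · rw [pi_eq_sum_univ' v]
      refine Submodule.sum_mem _ fun i _ => ?_
      by_cases hi : i ∈ J
      · exact Submodule.smul_mem _ _ (Submodule.subset_span ⟨⟨i, hi⟩, rfl⟩)
      · rw [hzero v hv i hi, zero_smul]
        exact Submodule.zero_mem _
    · rintro _ ⟨i, rfl⟩
      exact hsingle i i.2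
  refine ⟨J, ?_, fun v => ⟨hzero v, fun hv => ?_⟩, fun x hx i hi => ?_⟩
  · rw [hspan, finrank_span_eq_card, Fintype.card_coe]
    have := (Pi.basisFun ℝ (Fin n)).linearIndependent.comp (fun i : J => (i : Fin n))
      Subtype.val_injective
    convert this using 1
    ext i j
    simp
  · rw [pi_eq_sum_univ' v]
    refine Submodule.sum_mem _ fun i _ => ?_
    by_cases hi : i ∈ J
    · refine Submodule.smul_mem _ _ ?_
      exact hsingle i hi
    · rw [hv i hi, zero_smul]
      exact Submodule.zero_mem _
  · rw [hconst x hx i hi]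
    exact hJ i hi

/-- Three faces of a cube that contain a common face in codimension one lie in a face of
dimension at most three more. -/
theorem le_add_three_of_faces_Icc {n k : ℕ} (C : Faces (Set.Icc (0 : Fin n → ℝ) 1))
    (F : Fin 3 → Faces (Set.Icc (0 : Fin n → ℝ) 1)) (hC : C.1.Nonempty)
    (hCk : finrank ℝ (vectorSpan ℝ C.1) = k) (hFk : ∀ j, finrank ℝ (vectorSpan ℝ (F j).1) = k + 1)
    (hCF : ∀ j, C ≤ F j)
    (htop : ∀ Q : Faces (Set.Icc (0 : Fin n → ℝ) 1), (∀ j, F j ≤ Q) → Q.1 = Set.Icc 0 1) :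
    n ≤ k + 3 := by
  classical
  obtain ⟨JC, hJCcard, hJC, -⟩ := exists_free_coordinates C.2.1 C.2.2 hC
  have hex := fun j => exists_free_coordinates (F j).2.1 (F j).2.2 (hC.mono (hCF j))
  choose J hJcard hJ hJb using hex
  obtain ⟨p, hp⟩ := hC
  have hpF : ∀ j, p ∈ (F j).1 := fun j => hCF j hp
  have hsub : ∀ j, JC ⊆ J j := by
    intro j i hi
    by_contra hij
    have h1 : Pi.single i (1 : ℝ) ∈ vectorSpan ℝ C.1 := (hJC _).2 fun i' hi' => by
      rw [Pi.single_eq_of_ne]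
      rintro rfl
      exact hi' hi
    have h2 := (hJ j _).1 (vectorSpan_mono ℝ (hCF j) h1) i hij
    simp at h2
  -- This face frees exactly the coordinates free in some `F j`, so it contains each `F j` and is
  -- the whole cube. Hence every coordinate is free in some `F j`, and each `F j` adds only one to
  -- those of `C`.
  let Q : Set (Fin n → ℝ) := {x ∈ Set.Icc 0 1 | ∀ i, (∀ j, i ∉ J j) → x i = p i}
  have hQc : Convex ℝ Q := by
    refine (convex_Icc _ _).inter fun x hx y hy a b _ _ hab i hi => ?_
    rw [Pi.add_apply, Pi.smul_apply, Pi.smul_apply, hx i hi, hy i hi, ← add_smul, hab, one_smul]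
  have hQe : IsExtreme ℝ (Set.Icc 0 1) Q := by
    refine ⟨fun x hx => hx.1, fun x hx y hy z hz hxyz => ⟨hx, fun i hi => ?_⟩⟩
    obtain ⟨a, b, ha, hb, hab, rfl⟩ := hxyz
    have h := hz.2 i hi
    have hx0 := hx.1 i
    have hx1 := hx.2 i
    have hy0 := hy.1 i
    have hy1 := hy.2 i
    simp only [Pi.add_apply, Pi.smul_apply, smul_eq_mul, Pi.zero_apply,
      Pi.one_apply] at h hx0 hx1 hy0 hy1
    rcases hJb 0 p (hpF 0) i (hi 0) with hpi | hpi
    · rw [hpi] at h ⊢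
      nlinarith [mul_nonneg hb.le hy0]
    · rw [hpi] at h ⊢
      nlinarith [mul_nonneg hb.le (sub_nonneg.2 hy1)]
  have hQ := htop ⟨Q, hQc, hQe⟩ fun j x hx => ⟨(F j).2.2.subset hx, fun i hi => by
    have := (hJ j _).1 (vsub_mem_vectorSpan ℝ hx (hpF j)) i (hi j)
    rw [vsub_eq_sub, Pi.sub_apply] at this
    linarith⟩
  have hcover : ∀ i, ∃ j, i ∈ J j := by
    intro i
    by_contra! hi
    have h0 : (0 : Fin n → ℝ) ∈ Q := by
      rw [show Q = Set.Icc 0 1 from hQ]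
      exact ⟨le_rfl, zero_le_one⟩
    have h1 : (1 : Fin n → ℝ) ∈ Q := by
      rw [show Q = Set.Icc 0 1 from hQ]
      exact ⟨zero_le_one, le_rfl⟩
    exact zero_ne_one ((h0.2 i hi).trans (h1.2 i hi).symm)
  have hdiff : ∀ j, (J j \ JC).card = 1 := by
    intro j
    rw [Finset.card_sdiff_of_subset (hsub j), ← hJcard, ← hJCcard, hFk, hCk]
    omega
  have huniv : (Finset.univ : Finset (Fin n)) ⊆
      JC ∪ (Finset.univ : Finset (Fin 3)).biUnion fun j => J j \ JC := by
    intro i _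
    obtain ⟨j, hj⟩ := hcover i
    by_cases hi : i ∈ JC
    · exact Finset.mem_union_left _ hi
    · exact Finset.mem_union_right _
        (Finset.mem_biUnion.2 ⟨j, Finset.mem_univ _, Finset.mem_sdiff.2 ⟨hj, hi⟩⟩)
  have h1 := Finset.card_le_card huniv
  have h2 := Finset.card_union_le JC ((Finset.univ : Finset (Fin 3)).biUnion fun j => J j \ JC)
  have h3 : ((Finset.univ : Finset (Fin 3)).biUnion fun j => J j \ JC).card ≤ _ :=
    Finset.card_biUnion_le
  simp only [hdiff, Finset.sum_const, Finset.card_univ, Fintype.card_fin] at h1 h3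
  simp only [smul_eq_mul] at h3
  omega

theorem finrank_vectorSpan_Icc_le (n : ℕ) :
    finrank ℝ (vectorSpan ℝ (Set.Icc (0 : Fin n → ℝ) 1)) ≤ n :=
  (Submodule.finrank_le _).trans (by simp)

/-- The same for three faces of a combinatorial hypercube. -/
theorem finrank_le_add_three_of_faces {V : Type*} [AddCommGroup V] [Module ℝ V] {D : Set V}
    (hD : IsCombinatorialHypercube D) {k : ℕ} (C : Faces D) (F : Fin 3 → Faces D)
    (hC : C.1.Nonempty) (hCk : finrank ℝ (vectorSpan ℝ C.1) = k)
    (hFk : ∀ j, finrank ℝ (vectorSpan ℝ (F j).1) = k + 1) (hCF : ∀ j, C ≤ F j)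
    (htop : ∀ Q : Faces D, (∀ j, F j ≤ Q) → Q.1 = D) :
    finrank ℝ (vectorSpan ℝ D) ≤ k + 3 := by
  obtain ⟨hP, n, ⟨Φ⟩⟩ := hD
  have hP : IsPolytope D := hP
  have hcube := isPolytope_Icc n
  refine ((finrank_le_of_strictMono hP hcube Φ.strictMono).trans
    (finrank_vectorSpan_Icc_le n)).trans ?_
  refine le_add_three_of_faces_Icc (Φ C) (fun j => Φ (F j))
    (Faces.nonempty_map Φ.strictMono hC)
    (by rw [finrank_orderIso_apply hP hcube, hCk])
    (fun j => by rw [finrank_orderIso_apply hP hcube, hFk])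
    (fun j => Φ.monotone (hCF j)) fun Q hQ => ?_
  let T : Faces (Set.Icc (0 : Fin n → ℝ) 1) := ⟨_, convex_Icc _ _, IsExtreme.rfl⟩
  have h1 : (Φ.symm Q).1 = D := htop _ fun j => Φ.le_symm_apply.2 (hQ j)
  have h2 : Φ.symm T ≤ Φ.symm Q :=
    show (Φ.symm T).1 ≤ (Φ.symm Q).1 by rw [h1]; exact (Φ.symm T).2.2.subset
  exact Q.2.2.subset.antisymm (Φ.symm.le_iff_le.1 h2)

end Cube

/-! ### Assembling the cell. -/

section LinkCondition

open Module

variable {X : Type*} [PseudoMetricSpace X]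

theorem cellOf_mem_cells {f : X → ℝ} (hf : f ∈ hull' X) : cellOf f ∈ cells X := ⟨f, hf, rfl⟩

theorem finrank_cellOf_lt (hpoly : ∀ C ∈ cells X, IsPolytope C) {f g : X → ℝ}
    (hf : f ∈ hull' X) (hg : g ∈ cellOf f) (hne : cellOf g ≠ cellOf f) :
    finrank ℝ (vectorSpan ℝ (cellOf g)) < finrank ℝ (vectorSpan ℝ (cellOf f)) :=
  have hg' := mem_hull'_of_mem_cellOf hf hg
  finrank_lt_of_isExtreme (hpoly _ (cellOf_mem_cells hf)) (convex_cellOf hg')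
    (isExtreme_cellOf hf hg) ⟨g, self_mem_cellOf hg'⟩ hne

/-- The common edges of two distinct facets of a cell are the edges of the cell. -/
theorem edge_of_edge_facets (hpoly : ∀ C ∈ cells X, IsPolytope C) {f e e' : X → ℝ} {m : ℕ}
    (hf : f ∈ hull' X) (he : e ∈ cellOf f) (he' : e' ∈ cellOf f)
    (hdf : finrank ℝ (vectorSpan ℝ (cellOf f)) = m + 1)
    (hde : finrank ℝ (vectorSpan ℝ (cellOf e)) = m)
    (hde' : finrank ℝ (vectorSpan ℝ (cellOf e')) = m) (hne : cellOf e ≠ cellOf e') {x y : X}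
    (hxy : e x + e y = dist x y) (hxy' : e' x + e' y = dist x y) : f x + f y = dist x y := by
  -- The edges of the midpoint are the common edges of `e` and `e'`. Its cell is a face containing
  -- two distinct facets, hence all of `cellOf f`.
  let c : X → ℝ := (1 / 2 : ℝ) • e + (1 / 2 : ℝ) • e'
  have hc : c ∈ cellOf f :=
    convex_cellOf hf he he' (by norm_num) (by norm_num) (by norm_num)
  have hc' := mem_hull'_of_mem_cellOf hf hc
  have heΔ := ((mem_cellOf hf).1 he).1
  have heΔ' := ((mem_cellOf hf).1 he').1
  have hcv : ∀ x, c x = (e x + e' x) / 2 := fun x => by simp [c]; ring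
  have hec : e ∈ cellOf c := (mem_cellOf hc').2 ⟨heΔ, fun x y h => by
    rw [hcv, hcv] at h
    linarith [heΔ x y, heΔ' x y]⟩
  have hec' : e' ∈ cellOf c := (mem_cellOf hc').2 ⟨heΔ', fun x y h => by
    rw [hcv, hcv] at h
    linarith [heΔ x y, heΔ' x y]⟩
  have hcf : cellOf c = cellOf f := by
    by_contra hcf
    have h1 := finrank_cellOf_lt hpoly hf hc hcf
    have h2 : cellOf e = cellOf c := by
      by_contra h
      have := finrank_cellOf_lt hpoly hc' hec h
      omega
    have h3 : cellOf e' = cellOf c := by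
      by_contra h
      have := finrank_cellOf_lt hpoly hc' hec' h
      omega
    exact hne (h2.trans h3.symm)
  refine ((mem_cellOf hc').1 (hcf ▸ self_mem_cellOf hf : f ∈ cellOf c)).2 x y ?_
  rw [hcv, hcv]
  linarith

/-- The link condition for integral, totally split-decomposable spaces of locally finite rank
whose injective hull is made of combinatorial hypercubes. -/
theorem cat0LinkCondition_cells (hint : IntegerValued X) (hsplit : TotallySplitDecomposable X)
    (hlrc : LocalRankCondition X) (hcube : ∀ C ∈ cells X, IsCombinatorialHypercube C) :
    CAT0LinkCondition (cells X) := by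
  intro k C C₁ C₂ hC hC₁ hC₂ hCeq hC₁eq hdC hdC₁ hdC₂
  have hpoly : ∀ C ∈ cells X, IsPolytope C := fun C hC => (hcube C hC).1
  rw [cellDim_eq_natCast_iff (hpoly _ hC)] at hdC
  replace hdC₁ := fun i => (cellDim_eq_natCast_iff (hpoly _ (hC₁ i))).1 (hdC₁ i)
  replace hdC₂ := fun i => (cellDim_eq_natCast_iff (hpoly _ (hC₂ i))).1 (hdC₂ i)
  have h₁₂ : ∀ i j, i ≠ j → C₁ j ⊆ C₂ i := fun i j hij => by
    rw [hC₁eq j]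
    exact Set.iInter₂_subset i hij
  have hC₁₁ : ∀ j, C ⊆ C₁ j := fun j => by
    rw [hC₁eq j, hCeq]
    exact Set.subset_iInter₂ fun i _ => Set.iInter_subset _ i
  have hne : ∀ i j, i ≠ j → C₁ i ≠ C₁ j := by
    intro i j hij heq
    have : C₁ i ⊆ C := by
      rw [hCeq]
      refine Set.subset_iInter fun l => ?_
      by_cases hl : l = i
      · exact heq ▸ h₁₂ l j (hl ▸ hij)
      · exact h₁₂ l i hl
    have h := hdC₁ i
    rw [this.antisymm (hC₁₁ i)] at h
    omega
  obtain ⟨f₀, hf₀, hCf⟩ : ∃ f ∈ hull' X, C = cellOf f := hC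
  have hex₁ : ∀ i, ∃ f ∈ hull' X, C₁ i = cellOf f := hC₁
  have hex₂ : ∀ i, ∃ f ∈ hull' X, C₂ i = cellOf f := hC₂
  choose e he heC using hex₁
  choose f hf hfC using hex₂
  have hef : ∀ i j, i ≠ j → e j ∈ cellOf (f i) := fun i j hij => by
    rw [← hfC]
    exact h₁₂ i j hij (heC j ▸ self_mem_cellOf (he j))
  have hedge : ∀ l i j, l ≠ i → l ≠ j → i ≠ j → ∀ x y, e i x + e i y = dist x y →
      e j x + e j y = dist x y → f l x + f l y = dist x y := by
    intro l i j hli hlj hij x y hx hy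
    refine edge_of_edge_facets hpoly (hf l) (hef l i hli) (hef l j hlj) (m := k + 1)
      (by rw [← hfC, hdC₂]) (by rw [← heC, hdC₁]) (by rw [← heC, hdC₁]) ?_ hx hy
    rw [← heC, ← heC]
    exact hne i j hij
  have hpair : ∀ l i j, l ≠ i → l ≠ j → ∀ x,
      ∃ y, e i x + e i y = dist x y ∧ e j x + e j y = dist x y := by
    intro l i j hli hlj x
    obtain ⟨y, hy⟩ := (mem_hull'_iff.1 (hf l)).2 x
    exact ⟨y, ((mem_cellOf (hf l)).1 (hef l i hli)).2 x y hy,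
      ((mem_cellOf (hf l)).1 (hef l j hlj)).2 x y hy⟩
  let h : X → ℝ := fun x => (e 0 x + e 1 x + e 2 x) / 3
  have hiff : ∀ x y, h x + h y = dist x y ↔ ∀ j, e j x + e j y = dist x y := by
    intro x y
    have h0 := (he 0).1 x y
    have h1 := (he 1).1 x y
    have h2 := (he 2).1 x y
    simp only [h, Fin.forall_fin_succ, Fin.succ_zero_eq_one, Fin.succ_one_eq_two,
      IsEmpty.forall_iff, and_true]
    constructor
    · intro hh
      refine ⟨?_, ?_, ?_⟩ <;> linarith
    · rintro ⟨a, b, c⟩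
      linarith
  have hh : h ∈ hull' X := by
    refine mem_hull'_iff.2 ⟨fun x y => ?_, fun x => ?_⟩
    · have h0 := (he 0).1 x y
      have h1 := (he 1).1 x y
      have h2 := (he 2).1 x y
      simp only [h]
      linarith
    · obtain ⟨y, h0, h1, h2⟩ := exists_common_edge hsplit (he 0) (he 1) (he 2)
        (hpair 2 0 1 (by decide) (by decide) x) (hpair 1 0 2 (by decide) (by decide) x)
        (hpair 0 1 2 (by decide) (by decide) x)
      refine ⟨y, (hiff x y).2 fun j => ?_⟩
      fin_cases j
      exacts [h0, h1, h2]
  have hfD : ∀ i, f i ∈ cellOf h := by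
    refine fun i => (mem_cellOf hh).2 ⟨(hf i).1, fun x y hxy => ?_⟩
    have hx := (hiff x y).1 hxy
    obtain ⟨j, l, h1, h2, h3⟩ : ∃ j l, i ≠ j ∧ i ≠ l ∧ j ≠ l := by
      revert i; decide
    exact hedge i j l h1 h2 h3 x y (hx j) (hx l)
  have heD : ∀ j, e j ∈ cellOf h := fun j =>
    (mem_cellOf hh).2 ⟨(he j).1, fun x y hxy => (hiff x y).1 hxy j⟩
  have hsub : ∀ i, C₂ i ⊆ cellOf h := fun i => by
    rw [hfC]
    exact (isExtreme_cellOf hh (hfD i)).subset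
  have hf₀D : f₀ ∈ cellOf h :=
    hsub 0 (h₁₂ 0 1 (by decide) (hC₁₁ 1 (hCf ▸ self_mem_cellOf hf₀)))
  refine ⟨cellOf h, cellOf_mem_cells hh, ?_, Set.iUnion_subset hsub⟩
  rw [cellDim_eq_natCast_iff (hpoly _ (cellOf_mem_cells hh))]
  refine le_antisymm ?_ ?_
  · refine finrank_le_add_three_of_faces (hcube _ (cellOf_mem_cells hh))
      ⟨C, hCf ▸ convex_cellOf hf₀, hCf ▸ isExtreme_cellOf hh hf₀D⟩
      (fun j => ⟨C₁ j, heC j ▸ convex_cellOf (he j), heC j ▸ isExtreme_cellOf hh (heD j)⟩)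
      ⟨f₀, hCf ▸ self_mem_cellOf hf₀⟩ hdC hdC₁ hC₁₁ fun Q hQ => ?_
    have heQ : ∀ j, e j ∈ Q.1 := fun j =>
      hQ j (show e j ∈ C₁ j from heC j ▸ self_mem_cellOf (he j))
    refine eq_cellOf_of_isExtreme hint hlrc hh Q.2.2 ?_
    have hQ := Q.2.1
    -- The barycentre is two thirds of this midpoint plus one third of `e 2`.
    have hmid := hQ (heQ 0) (heQ 1) (a := 1 / 2) (b := 1 / 2) (by norm_num) (by norm_num)
      (by norm_num)
    have := hQ hmid (heQ 2) (a := 2 / 3) (b := 1 / 3) (by norm_num) (by norm_num)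
      (by norm_num)
    convert this using 1
    ext x
    simp only [h, Pi.add_apply, Pi.smul_apply, smul_eq_mul]
    ring
  -- If `C₂ 0` were the whole cell, it would contain `C₂ 1`, and the intersection `C₁ 2` would be
  -- `C₂ 1`, whose dimension is too large.
  · have hlt := finrank_cellOf_lt hpoly hh (hfD 0) fun heq => by
      have h1 : C₂ 1 ⊆ C₂ 0 := by
        rw [hfC 0, heq]
        exact hsub 1
      have h2 : C₁ 2 = C₂ 1 := by
        refine (h₁₂ 1 2 (by decide)).antisymm ?_
        rw [hC₁eq 2]
        refine Set.subset_iInter₂ fun i hi => ?_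
        fin_cases i
        exacts [h1, subset_rfl, absurd rfl hi]
      have h3 := hdC₁ 2
      rw [h2, hdC₂] at h3
      omega
    rw [← hfC, hdC₂] at hlt
    omega

end LinkCondition

end InjHull

theorem theorem4p2 (X : Type*) [MetricSpace X]
    (hint : InjHull.IntegerValued X)
    (hsplit : InjHull.TotallySplitDecomposable X)
    (hlrc : InjHull.LocalRankCondition X)
    (hcube : ∀ C ∈ InjHull.cells X, InjHull.IsCombinatorialHypercube C) :
    InjHull.CAT0LinkCondition (InjHull.cells X) :=
  InjHull.cat0LinkCondition_cells hint hsplit hlrc hcube
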